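/- For real $x>0$ let $$L^*(x)=\lfloor\log_2 x\rfloor+2\bigl(1-2^{\lfloor\log_2 x\rfloor-\log_2 x}\bigr).$$ Consider the binary erasure channel BEC$(\delta)$, $0\le\delta<1$, with input alphabet $\{0,1\}$, output alphabet $\{0,\mathsf e,1\}$ and transition probabilities $P(\mathsf e\mid x)=\delta$, $P(x\mid x)=1-\delta$. For a real $L\ge 0$, an integer $M\ge 1$ and $\epsilon\in[0,1]$, an $(L,M,\epsilon)$ variable-length feedback (VLF) code over BEC$(\delta)$ consists of 1. a random variable $U$ with values in a set $\mathcal U$ with $|\mathcal U|\le 2$, known to encoder and decoder, and independent of the message $W$, which is uniformly distributed on $\{1,\dots,M\}$; 2. encoders $f_n:\mathcal U\times\{1,\dots,M\}\times\{0,\mathsf e,1\}^{n-1}\to\{0,1\}$, $n\ge1$, giving the channel inputs $X_n=f_n(U,W,Y_1,\dots,Y_{n-1})$, where, conditionally on $(U,W,Y_1,\dots,Y_{n-1})$, the output $Y_n$ has the distribution $P(\cdot\mid X_n)$; 3. decoders $g_n:\mathcal U\times\{0,\mathsf e,1\}^n\to\{1,\dots,M\}$, $n\ge0$; 4. a random variable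 $\tau$ with values in $\{0,1,2,\dots\}$, which is a stopping time of the filtration $\mathcal G_n=\sigma(U,Y_1,\dots,Y_n)$, with $\mathbb E[\tau]\le L$, such that $\Pr[g_\tau(U,Y_1,\dots,Y_\tau)\ne W]\le\epsilon$. Then for every $\delta\in[0,1)$ and every integer $M\ge1$, the minimum $$L^*_{\mathrm f}(M,0)=\min\{L\ge 0:\ \text{there is an }(L,M,0)\text{ VLF code over BEC}(\delta)\}$$ exists and equals $$\frac{L^*(M)}{1-\delta}.$$ That is, there is an $(L,M,0)$ VLF code with $L=L^*(M)/(1-\delta)$, and every $(L,M,0)$ VLF code satisfies $L\ge L^*(M)/(1-\delta)$. -/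

import Mathlib

open MeasureTheory ProbabilityTheory
open scoped ENNReal

/-- The function `L*(x) = ⌊log₂ x⌋ + 2 (1 - 2 ^ (⌊log₂ x⌋ - log₂ x))`. -/
noncomputable def lstar (x : ℝ) : ℝ :=
  (⌊Real.logb 2 x⌋ : ℝ) + 2 * (1 - (2 : ℝ) ^ ((⌊Real.logb 2 x⌋ : ℝ) - Real.logb 2 x))

/-- The output alphabet `{0, e, 1}` of the binary erasure channel: `none` is the erasure and
`some b` is the correctly received bit `b`. The input alphabet is `Bool`. -/
abbrev BECOutput : Type := Option Bool

/-- The output alphabet carries the discrete σ-algebra. -/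
instance BECOutput.instMeasurableSpace : MeasurableSpace BECOutput := ⊤

/-- The transition probabilities `P(y | x)` of the binary erasure channel with erasure
probability `δ`. -/
def becTransition (δ : ℝ) (x : Bool) (y : BECOutput) : ℝ :=
  match y with
  | none => δ
  | some b => if b = x then 1 - δ else 0

/-- The filtration `𝒢 n = σ(U, Y₁, …, Yₙ)`. The process is indexed from zero, so that `Y k` is the
channel output at time `k + 1` and `𝒢 n` is generated by `U` and the `Y k` with `k < n`. -/
def feedbackFiltration {Ω S : Type} [mΩ : MeasurableSpace Ω] [mS : MeasurableSpace S]
    (U : Ω → S) (Y : ℕ → Ω → BECOutput) (hU : Measurable U) (hY : ∀ k, Measurable (Y k)) :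
    Filtration ℕ mΩ where
  seq n := MeasurableSpace.comap U mS ⊔
    ⨆ k : ℕ, ⨆ _ : k < n, MeasurableSpace.comap (Y k) BECOutput.instMeasurableSpace
  mono' := by
    intro i j hij
    refine sup_le_sup le_rfl (iSup_mono fun k => ?_)
    exact iSup_le fun hk => le_iSup_of_le (lt_of_lt_of_le hk hij) le_rfl
  le' _ := sup_le hU.comap_le (iSup_le fun k => iSup_le fun _ => (hY k).comap_le)

/-- An `(L, M, ε)` variable-length feedback code operating over the binary erasure channel with
erasure probability `δ`, together with the random variables that it induces. -/
structure VLFCode (δ L : ℝ) (M : ℕ) (ε : ℝ) where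
  L_nonneg : 0 ≤ L
  ε_mem : ε ∈ Set.Icc (0 : ℝ) 1
  /-- The set in which the common randomness takes its values; it has at most two elements. -/
  S : Type
  [fintypeS : Fintype S]
  [measurableSpaceS : MeasurableSpace S]
  [discreteS : DiscreteMeasurableSpace S]
  card_S_le : Fintype.card S ≤ 2
  /-- The encoders: `enc n` maps the common randomness, the message and the first `n` channel
  outputs to the channel input at time `n + 1`. -/
  enc : (n : ℕ) → S → Fin M → (Fin n → BECOutput) → Bool
  /-- The decoders: `dec n` estimates the message from the common randomness and the first `n`
  channel outputs. -/
  dec : (n : ℕ) → S → (Fin n → BECOutput) → Fin M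
  /-- The probability space. -/
  Ω : Type
  [measurableSpaceΩ : MeasurableSpace Ω]
  μ : Measure Ω
  [isProbabilityMeasure : IsProbabilityMeasure μ]
  /-- The common randomness. -/
  U : Ω → S
  /-- The message. -/
  W : Ω → Fin M
  /-- The channel outputs: `Y n` is the output at time `n + 1`. -/
  Y : ℕ → Ω → BECOutput
  measurable_U : Measurable U
  measurable_W : Measurable W
  measurable_Y : ∀ n, Measurable (Y n)
  /-- The message is uniformly distributed. -/
  uniform_W : ∀ w : Fin M, μ.real {ω | W ω = w} = 1 / (M : ℝ)
  /-- The common randomness is independent of the message. -/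
  indep_U_W : IndepFun U W μ
  /-- Given `U`, `W` and the first `n` outputs, the next output is that of the channel for the
  input `enc n U W (Y 0, …, Y (n - 1))`. -/
  channel : ∀ (n : ℕ) (u : S) (w : Fin M) (y : Fin n → BECOutput) (b : BECOutput),
    μ.real {ω | U ω = u ∧ W ω = w ∧ (∀ k : Fin n, Y k ω = y k) ∧ Y n ω = b} =
      μ.real {ω | U ω = u ∧ W ω = w ∧ ∀ k : Fin n, Y k ω = y k} *
        becTransition δ (enc n u w y) b
  /-- The (integer-valued) time at which the transmission stops. -/
  τ : Ω → ℕ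
  isStoppingTime : IsStoppingTime (feedbackFiltration U Y measurable_U measurable_Y)
    (fun ω => (τ ω : WithTop ℕ))
  /-- The average blocklength is at most `L`. -/
  expectation_le : ∫⁻ ω, (τ ω : ℝ≥0∞) ∂μ ≤ ENNReal.ofReal L
  /-- The final estimate differs from the message with probability at most `ε`. -/
  error_le : μ.real {ω | dec (τ ω) (U ω) (fun k => Y k ω) ≠ W ω} ≤ ε

/-- The set of all `L` for which an `(L, M, ε)` variable-length feedback code over the binary
erasure channel with erasure probability `δ` exists. Its least element is the minimum average
blocklength. -/
def vlfBlocklengths (δ : ℝ) (M : ℕ) (ε : ℝ) : Set ℝ :=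
  {L | Nonempty (VLFCode δ L M ε)}

/-! The proof tracks a potential: the probability of a history `(u, y)` times `lstar m`, where `m`
is the number of messages still compatible with it. `W` is uniform and independent of `U`, and every
output either scales all masses by `δ` or keeps those of the messages whose input bit agrees and
scales them by `1 - δ`. Hence the surviving messages always have equal mass (`isFlat_jointMass`),
and the potential of a history is that common mass times `totalLength m`.

An erasure changes nothing, while a received bit splits `m` into `a + b`. Since `totalLength (a + b)
≤ totalLength a + totalLength b + (a + b)`, one channel use lowers the expected potential by at most
`(1 - δ) * P(n < τ)`. Stopped histories of a zero-error code have potential zero. The initial value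
is `lstar M`, so summing over time gives `lstar M ≤ (1 - δ) * L` (`VLFCode.lstar_div_le`).

Splitting into halves gives equality (`totalLength_half`). Bisecting the candidates, with each bit
repeated until it is received, therefore meets the bound, without common randomness
(`nonempty_vlfCode`). -/

/-! ### Arithmetic of the optimal codeword length. -/

/-- The total codeword length `m * L*(m)` of an optimal binary prefix code for `m` equally likely
messages. -/
noncomputable def totalLength (m : ℕ) : ℝ := m * lstar m

theorem totalLength_zero : totalLength 0 = 0 := by simp [totalLength]

theorem totalLength_eq_log {m : ℕ} (hm : m ≠ 0) :
    totalLength m = m * (Nat.log 2 m + 2) - 2 ^ (Nat.log 2 m + 1) := by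
  have hm' : (0 : ℝ) < m := by positivity
  have hfloor : ⌊Real.logb 2 (m : ℝ)⌋ = (Nat.log 2 m : ℤ) := by
    have := Real.floor_logb_natCast (b := 2) (r := (m : ℝ)) hm'.le
    rw [Int.log_natCast] at this
    exact_mod_cast this
  rw [totalLength, lstar, hfloor, Real.rpow_sub (by norm_num),
    Real.rpow_logb (by norm_num) (by norm_num) hm', Int.cast_natCast, Real.rpow_natCast]
  field_simp
  ring

/-- A lower bound for `totalLength` which is attained for `2 ^ j ≤ m ≤ 2 ^ (j + 1)`. -/
theorem le_totalLength (m j : ℕ) : (m : ℝ) * (j + 2) - 2 ^ (j + 1) ≤ totalLength m := by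
  rcases Nat.eq_zero_or_pos m with rfl | hm
  · simp [totalLength_zero]
  rw [totalLength_eq_log hm.ne']
  have h1 : (2 : ℝ) ^ Nat.log 2 m ≤ m := by exact_mod_cast Nat.pow_log_le_self 2 hm.ne'
  have h2 : (m : ℝ) ≤ 2 ^ (Nat.log 2 m + 1) := by
    exact_mod_cast (Nat.lt_pow_succ_log_self (by norm_num) m).le
  generalize Nat.log 2 m = k at *
  -- With `j = k + d` the gap is `2 ^ (k + 1) * (2 ^ d - 1) - m * d`, controlled by `m ≤ 2 ^ (k +
  -- 1)`. With `k = j + d + 1` it is `m * (d + 1) - 2 ^ (j + 1) * (2 * 2 ^ d - 1)`, controlled by `2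
  -- ^ k ≤ m`.
  rcases le_total k j with h | h
  · obtain ⟨d, rfl⟩ := Nat.exists_eq_add_of_le h
    have h3 : (d : ℝ) + 1 ≤ 2 ^ d := by exact_mod_cast Nat.lt_two_pow_self (n := d)
    have h4 : (m : ℝ) * d ≤ 2 ^ (k + 1) * (2 ^ d - 1) := by
      apply mul_le_mul h2 (by linarith) (by positivity) (by positivity)
    have h5 : (2 : ℝ) ^ (k + d + 1) = 2 ^ (k + 1) * 2 ^ d := by ring
    rw [h5]; push_cast; linarith
  · obtain ⟨d, rfl⟩ := Nat.exists_eq_add_of_le h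
    rcases d with _ | d
    · simp
    have h3 : (2 : ℝ) * 2 ^ d ≤ (d + 1) * 2 ^ d + 1 := by
      rcases d with _ | d
      · norm_num
      · have : (0 : ℝ) ≤ d * 2 ^ (d + 1) := by positivity
        push_cast; linarith
    have h4 : (2 : ℝ) ^ (j + (d + 1)) * (d + 1) ≤ m * (d + 1) := by gcongr
    have h6 : (2 : ℝ) ^ (j + 1) * (2 * 2 ^ d) ≤ 2 ^ (j + 1) * ((d + 1) * 2 ^ d + 1) := by gcongr
    have h7 : (2 : ℝ) ^ (j + (d + 1)) = 2 ^ (j + 1) * 2 ^ d := by ring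
    have h8 : (2 : ℝ) ^ (j + (d + 1) + 1) = 2 ^ (j + 1) * (2 * 2 ^ d) := by ring
    rw [h8]; rw [h7] at h4; push_cast; linarith

/-- Adjacent affine pieces agree at `2 ^ (j + 1)`, so the right endpoint may be included;
`totalLength_half` needs it when a half is exactly a power of two. -/
theorem totalLength_eq {m j : ℕ} (h1 : 2 ^ j ≤ m) (h2 : m ≤ 2 ^ (j + 1)) :
    totalLength m = m * (j + 2) - 2 ^ (j + 1) := by
  have hm : m ≠ 0 := (lt_of_lt_of_le (by positivity) h1).ne'
  rw [totalLength_eq_log hm]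
  rcases h2.lt_or_eq with h | h
  · rw [Nat.log_eq_of_pow_le_of_lt_pow h1 h]
  · rw [h, Nat.log_pow (by norm_num)]
    push_cast
    ring

theorem totalLength_one : totalLength 1 = 0 := by
  rw [totalLength_eq (j := 0) (by norm_num) (by norm_num)]; norm_num

theorem totalLength_nonneg (m : ℕ) : 0 ≤ totalLength m := by
  rcases Nat.eq_zero_or_pos m with rfl | hm
  · rw [totalLength_zero]
  · have h : (1 : ℝ) ≤ m := by exact_mod_cast hm
    have := le_totalLength m 0
    norm_num at this
    linarith

theorem totalLength_eq_zero_of_le_one {m : ℕ} (hm : m ≤ 1) : totalLength m = 0 := by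
  interval_cases m
  exacts [totalLength_zero, totalLength_one]

theorem lstar_natCast_nonneg (m : ℕ) : 0 ≤ lstar m := by
  rcases Nat.eq_zero_or_pos m with rfl | hm
  · simp [lstar]
  · exact nonneg_of_mul_nonneg_right (totalLength_nonneg m) (by exact_mod_cast hm)

/-- If `k + 1` is the logarithm of `a + b`, the affine lower bounds of index `k` at `a` and at `b`
add up to exactly `totalLength (a + b) - (a + b)`. -/
theorem totalLength_add_le (a b : ℕ) :
    totalLength (a + b) ≤ totalLength a + totalLength b + (a + b : ℕ) := by
  rcases le_or_gt (a + b) 1 with h | h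
  · rw [totalLength_eq_zero_of_le_one h]
    have := totalLength_nonneg a
    have := totalLength_nonneg b
    positivity
  · rw [totalLength_eq_log (by omega)]
    obtain ⟨k, hk⟩ : ∃ k, Nat.log 2 (a + b) = k + 1 :=
      Nat.exists_eq_succ_of_ne_zero (Nat.log_pos (by norm_num) h).ne'
    have h1 := le_totalLength a k
    have h2 := le_totalLength b k
    rw [hk, pow_succ (2 : ℝ) (k + 1)]
    push_cast
    linarith

/-- Both halves lie in `[2 ^ k, 2 ^ (k + 1)]`, where the affine bound of index `k` is attained, so
subadditivity becomes an equality. -/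
theorem totalLength_half {m : ℕ} (hm : 2 ≤ m) :
    totalLength m = totalLength (m / 2) + totalLength (m - m / 2) + m := by
  obtain ⟨k, hk⟩ : ∃ k, Nat.log 2 m = k + 1 :=
    Nat.exists_eq_succ_of_ne_zero (Nat.log_pos (by norm_num) hm).ne'
  have h1 := Nat.pow_log_le_self 2 (show m ≠ 0 by omega)
  have h2 := Nat.lt_pow_succ_log_self (b := 2) (by norm_num) m
  rw [totalLength_eq_log (by omega), hk]
  rw [hk] at h1 h2
  have e1 : 2 ^ (k + 1) = 2 * 2 ^ k := by ring
  have e2 : 2 ^ (k + 1 + 1) = 2 * (2 * 2 ^ k) := by ring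
  rw [e1] at h1
  rw [Nat.succ_eq_add_one, e2] at h2
  rw [totalLength_eq (j := k) (by omega) (by omega), totalLength_eq (j := k) (by omega) (by omega),
    Nat.cast_sub (Nat.div_le_self m 2)]
  push_cast
  ring

/-- The expectation of a natural-valued random variable is the sum of its tail probabilities. -/
theorem lintegral_natCast_eq_tsum {Ω : Type*} [MeasurableSpace Ω] (μ : Measure Ω) {τ : Ω → ℕ}
    (hτ : ∀ n, MeasurableSet {ω | n < τ ω}) :
    ∫⁻ ω, (τ ω : ℝ≥0∞) ∂μ = ∑' n : ℕ, μ {ω | n < τ ω} := by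
  have h : ∀ ω, (τ ω : ℝ≥0∞) = ∑' n : ℕ, {ω | n < τ ω}.indicator 1 ω := by
    intro ω
    rw [tsum_eq_sum (s := Finset.range (τ ω))]
    · simp only [Set.indicator_apply, Set.mem_ofPred_eq, Pi.one_apply]
      rw [Finset.sum_ite_of_true fun n hn => Finset.mem_range.1 hn]
      simp
    · intro n hn
      simpa using hn
  simp_rw [h]
  rw [lintegral_tsum fun n => (measurable_one.indicator (hτ n)).aemeasurable]
  exact tsum_congr fun n => lintegral_indicator_one (hτ n)

/-! ### The potential and its change over one channel use. -/

/-- For a vector `P` of masses of the messages, the total mass times the average length of an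
optimal prefix code for the messages of nonzero mass. -/
noncomputable def potential {M : ℕ} (P : Fin M → ℝ) : ℝ :=
  (∑ w, P w) * lstar ((Finset.univ.filter fun w => P w ≠ 0).card : ℕ)

theorem potential_ite {M : ℕ} (A : Finset (Fin M)) (c : ℝ) :
    potential (fun w => if w ∈ A then c else 0) = c * totalLength A.card := by
  -- For `c = 0` the support is empty instead of `A`, but both sides vanish.
  rcases eq_or_ne c 0 with rfl | hc
  · simp [potential]
  · simp [potential, totalLength, hc]
    ring

theorem potential_nonneg {M : ℕ} {P : Fin M → ℝ} (hP : ∀ w, 0 ≤ P w) : 0 ≤ potential P :=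
  mul_nonneg (Finset.sum_nonneg fun w _ => hP w) (lstar_natCast_nonneg _)

theorem potential_eq_zero {M : ℕ} {P : Fin M → ℝ} (hP : ∀ w w', P w ≠ 0 → P w' ≠ 0 → w = w') :
    potential P = 0 := by
  have hcard : (Finset.univ.filter fun w => P w ≠ 0).card ≤ 1 :=
    Finset.card_le_one.2 fun a ha b hb => hP a b (by simpa using ha) (by simpa using hb)
  rcases Nat.le_one_iff_eq_zero_or_eq_one.1 hcard with h | h
  · simp [potential, h, lstar]
  · simp [potential, h, lstar]

theorem becTransition_nonneg {δ : ℝ} (h0 : 0 ≤ δ) (h1 : δ < 1) (x : Bool) (b : BECOutput) :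
    0 ≤ becTransition δ x b := by
  rcases b with _ | b
  · exact h0
  · simp only [becTransition]
    split_ifs <;> linarith

/-- The potential of the masses after one use of the channel. -/
theorem sum_potential_mul_becTransition {M : ℕ} (δ : ℝ) (A : Finset (Fin M)) (c : ℝ)
    (e : Fin M → Bool) :
    ∑ b, potential (fun w => (if w ∈ A then c else 0) * becTransition δ (e w) b) =
      δ * (c * totalLength A.card) +
        (1 - δ) * (c * (totalLength (A.filter fun w => e w = false).card +
          totalLength (A.filter fun w => e w = true).card)) := by
  have h (x : Bool) :
      potential (fun w => (if w ∈ A then c else 0) * becTransition δ (e w) (some x)) =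
        (1 - δ) * (c * totalLength (A.filter fun w => e w = x).card) := by
    rw [← mul_assoc, ← potential_ite]
    congr 1
    ext w
    by_cases hA : w ∈ A <;> by_cases hx : e w = x <;>
      simp [hA, hx, becTransition, mul_comm, eq_comm (a := x)]
  have h0 : potential (fun w => (if w ∈ A then c else 0) * becTransition δ (e w) none) =
      δ * (c * totalLength A.card) := by
    rw [← mul_assoc, ← potential_ite]
    congr 1
    ext w
    by_cases hA : w ∈ A <;> simp [hA, becTransition, mul_comm]
  rw [Fintype.sum_option, Fintype.sum_bool, h0, h, h]
  ring

/-- The messages of nonzero mass all have the same mass. -/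
def IsFlat {M : ℕ} (P : Fin M → ℝ) : Prop :=
  ∃ (A : Finset (Fin M)) (c : ℝ), 0 ≤ c ∧ ∀ w, P w = if w ∈ A then c else 0

theorem IsFlat.mul_becTransition {M : ℕ} {P : Fin M → ℝ} (hP : IsFlat P) {δ : ℝ} (h0 : 0 ≤ δ)
    (h1 : δ < 1) (e : Fin M → Bool) (b : BECOutput) :
    IsFlat fun w => P w * becTransition δ (e w) b := by
  obtain ⟨A, c, hc, hA⟩ := hP
  rcases b with _ | x
  · refine ⟨A, c * δ, by positivity, fun w => ?_⟩
    simp [hA, becTransition]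
  · refine ⟨A.filter fun w => e w = x, c * (1 - δ), mul_nonneg hc (by linarith), fun w => ?_⟩
    by_cases h : w ∈ A <;> by_cases hx : e w = x <;>
      simp [hA, h, hx, becTransition, eq_comm (a := x)]

/-- Flatness turns the potential into a multiple of `totalLength`. The erasure term returns the
fraction `δ` of it, and `totalLength_add_le` bounds the loss in the remaining `1 - δ`. -/
theorem IsFlat.potential_le {M : ℕ} {P : Fin M → ℝ} (hP : IsFlat P) {δ : ℝ} (h1 : δ < 1)
    (e : Fin M → Bool) :
    potential P ≤ ∑ b, potential (fun w => P w * becTransition δ (e w) b) +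
      (1 - δ) * ∑ w, P w := by
  obtain ⟨A, c, hc, hA⟩ := hP
  obtain rfl : P = fun w => if w ∈ A then c else 0 := funext hA
  rw [sum_potential_mul_becTransition, potential_ite]
  have hsum : ∑ w, (if w ∈ A then c else 0) = c * A.card := by simp [mul_comm]
  have hcard : (A.filter fun w => e w = false).card + (A.filter fun w => e w = true).card
      = A.card := by
    rw [← Finset.card_filter_add_card_filter_not (s := A) (fun w => e w = false)]
    simp
  have h := totalLength_add_le (A.filter fun w => e w = false).card
    (A.filter fun w => e w = true).card
  rw [hcard] at h
  have := mul_le_mul_of_nonneg_left h (mul_nonneg (sub_nonneg.2 h1.le) hc)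
  rw [hsum]
  linarith

theorem sum_fin_succ_eq_sum_snoc {α β : Type*} [Fintype α] [AddCommMonoid β] {n : ℕ}
    (F : (Fin (n + 1) → α) → β) :
    ∑ y, F y = ∑ y : Fin n → α, ∑ b, F (Fin.snoc y b) := by
  rw [← Fintype.sum_prod_type', ← (Fin.snocEquiv fun _ => α).sum_comp F, ← Finset.univ_product_univ,
    ← (Equiv.prodComm _ _).sum_comp]
  rfl

/-! ### Joint masses of messages and histories. -/

section JointMass

variable {Ω S : Type} [MeasurableSpace Ω] {M : ℕ}

/-- The probability that `U = u`, `W = w` and that the first `n` outputs are `y`. -/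
noncomputable def jointMass (μ : Measure Ω) (U : Ω → S) (W : Ω → Fin M) (Y : ℕ → Ω → BECOutput)
    (n : ℕ) (u : S) (y : Fin n → BECOutput) (w : Fin M) : ℝ :=
  μ.real {ω | U ω = u ∧ W ω = w ∧ ∀ k : Fin n, Y k ω = y k}

theorem jointMass_nonneg (μ : Measure Ω) (U : Ω → S) (W : Ω → Fin M) (Y : ℕ → Ω → BECOutput)
    (n : ℕ) (u : S) (y : Fin n → BECOutput) (w : Fin M) : 0 ≤ jointMass μ U W Y n u y w :=
  measureReal_nonneg

theorem jointMass_snoc (μ : Measure Ω) (U : Ω → S) (W : Ω → Fin M) (Y : ℕ → Ω → BECOutput)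
    (n : ℕ) (u : S) (y : Fin n → BECOutput) (b : BECOutput) (w : Fin M) :
    jointMass μ U W Y (n + 1) u (Fin.snoc y b) w =
      μ.real {ω | U ω = u ∧ W ω = w ∧ (∀ k : Fin n, Y k ω = y k) ∧ Y n ω = b} := by
  simp [jointMass, Fin.forall_fin_succ']

/-- This converts per-history estimates into event probabilities. It is applied with `T` saying that
transmission is running, or that at least two candidates remain. -/
theorem sum_jointMass {μ : Measure Ω} [IsFiniteMeasure μ] [Fintype S] [MeasurableSpace S]
    [DiscreteMeasurableSpace S] {U : Ω → S} {W : Ω → Fin M}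
    {Y : ℕ → Ω → BECOutput} (hU : Measurable U) (hW : Measurable W) (hY : ∀ k, Measurable (Y k))
    (n : ℕ) (T : S → (Fin n → BECOutput) → Prop) [∀ u y, Decidable (T u y)] :
    ∑ u, ∑ y, (if T u y then ∑ w, jointMass μ U W Y n u y w else 0) =
      μ.real {ω | T (U ω) fun k => Y k ω} := by
  classical
  have : DiscreteMeasurableSpace BECOutput := ⟨fun _ => trivial⟩
  let f : Ω → (S × (Fin n → BECOutput)) × Fin M := fun ω => ((U ω, fun k => Y k ω), W ω)
  have hf : Measurable f :=
    (hU.prodMk (measurable_pi_lambda (fun ω (k : Fin n) => Y k ω) fun k => hY k)).prodMk hW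
  have h := sum_measureReal_preimage_singleton (μ := μ)
    (Finset.univ.filter fun p : (S × (Fin n → BECOutput)) × Fin M => T p.1.1 p.1.2) (f := f)
    (fun p _ => hf (measurableSet_singleton p)) 
  rw [Finset.sum_filter, Fintype.sum_prod_type, Fintype.sum_prod_type] at h
  convert h using 1
  · refine Finset.sum_congr rfl fun u _ => Finset.sum_congr rfl fun y _ => ?_
    split_ifs with hT
    · refine Finset.sum_congr rfl fun w _ => ?_
      rw [jointMass]
      congr 1
      ext ω
      simp [f, funext_iff, and_comm, and_left_comm]
    · simp
  · congr 1
    ext ω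
    simp [f]

end JointMass

/-! ### Converse: every zero-error code is at least this long. -/

/-- Events of the filtration at time `n` depend only on `U` and the first `n` outputs. -/
theorem mem_iff_of_measurableSet_feedbackFiltration {Ω S : Type} [MeasurableSpace Ω]
    [MeasurableSpace S] {U : Ω → S} {Y : ℕ → Ω → BECOutput} {hU : Measurable U}
    {hY : ∀ k, Measurable (Y k)} {n : ℕ} {s : Set Ω}
    (hs : MeasurableSet[feedbackFiltration U Y hU hY n] s) {ω ω' : Ω} (h : U ω = U ω')
    (h' : ∀ k < n, Y k ω = Y k ω') : ω ∈ s ↔ ω' ∈ s := by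
  have hle : feedbackFiltration U Y hU hY n ≤
      MeasurableSpace.comap (fun ω => (U ω, fun k : Fin n => Y k ω)) ⊤ := by
    refine sup_le ?_ (iSup_le fun k => iSup_le fun hk => ?_)
    · rintro _ ⟨t, -, rfl⟩
      exact ⟨Prod.fst ⁻¹' t, trivial, rfl⟩
    · rintro _ ⟨t, -, rfl⟩
      exact ⟨(fun p => p.2 ⟨k, hk⟩) ⁻¹' t, trivial, rfl⟩
  obtain ⟨t, -, rfl⟩ := hle s hs
  have : (fun k : Fin n => Y k ω) = fun k : Fin n => Y k ω' := funext fun k => h' k k.2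
  simp [h, this]

namespace VLFCode

variable {δ L ε : ℝ} {M : ℕ}

attribute [instance] fintypeS measurableSpaceS discreteS measurableSpaceΩ isProbabilityMeasure

theorem jointMass_snoc_eq (C : VLFCode δ L M ε) (n : ℕ) (u : C.S) (y : Fin n → BECOutput)
    (b : BECOutput) (w : Fin M) :
    jointMass C.μ C.U C.W C.Y (n + 1) u (Fin.snoc y b) w =
      jointMass C.μ C.U C.W C.Y n u y w * becTransition δ (C.enc n u w y) b := by
  rw [jointMass_snoc, C.channel, jointMass]

theorem jointMass_zero (C : VLFCode δ L M ε) (u : C.S) (y : Fin 0 → BECOutput) (w : Fin M) :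
    jointMass C.μ C.U C.W C.Y 0 u y w = C.μ.real {ω | C.U ω = u} / M := by
  have h := congrArg ENNReal.toReal (C.indep_U_W.measure_inter_preimage_eq_mul {u} {w}
    (measurableSet_singleton u) (measurableSet_singleton w))
  rw [ENNReal.toReal_mul] at h
  have h' := C.uniform_W w
  simp only [jointMass, IsEmpty.forall_iff, and_true]
  change C.μ.real {ω | C.U ω = u ∧ C.W ω = w} = C.μ.real {ω | C.U ω = u} * C.μ.real {ω | C.W ω = w} at h
  rw [h, h']
  ring

theorem isFlat_jointMass (C : VLFCode δ L M ε) (h0 : 0 ≤ δ) (h1 : δ < 1) (n : ℕ) (u : C.S)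
    (y : Fin n → BECOutput) : IsFlat (jointMass C.μ C.U C.W C.Y n u y) := by
  induction n with
  | zero =>
    exact ⟨Finset.univ, C.μ.real {ω | C.U ω = u} / M, by positivity, fun w => by
      simp [C.jointMass_zero]⟩
  | succ n ih =>
    have h := (ih (Fin.init y)).mul_becTransition h0 h1 (fun w => C.enc n u w (Fin.init y))
      (y (Fin.last n))
    rw [← Fin.snoc_init_self y]
    convert h using 1
    ext w
    exact C.jointMass_snoc_eq n u _ _ w

theorem τ_le_iff_of_eq (C : VLFCode δ L M ε) {n : ℕ} {ω ω' : C.Ω} (h : C.U ω = C.U ω')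
    (h' : ∀ k < n, C.Y k ω = C.Y k ω') : C.τ ω ≤ n ↔ C.τ ω' ≤ n := by
  have := mem_iff_of_measurableSet_feedbackFiltration (C.isStoppingTime n) h h'
  simpa using this

/-- The stopping rule is compared at time `τ ω` and then at time `τ ω'`. Both are at most `n`, so
agreement of the first `n` outputs suffices. -/
theorem τ_eq_of_eq (C : VLFCode δ L M ε) {n : ℕ} {ω ω' : C.Ω} (h : C.U ω = C.U ω')
    (h' : ∀ k < n, C.Y k ω = C.Y k ω') (hn : C.τ ω ≤ n) : C.τ ω = C.τ ω' := by
  have hle : C.τ ω' ≤ C.τ ω :=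
    (C.τ_le_iff_of_eq h fun k hk => h' k (hk.trans_le hn)).1 le_rfl
  exact le_antisymm
    ((C.τ_le_iff_of_eq h fun k hk => h' k (hk.trans_le (hle.trans hn))).2 le_rfl) hle

theorem dec_eq_of_eq (C : VLFCode δ L M ε) {n : ℕ} {ω ω' : C.Ω} (h : C.U ω = C.U ω')
    (h' : ∀ k < n, C.Y k ω = C.Y k ω') (hn : C.τ ω ≤ n) :
    C.dec (C.τ ω) (C.U ω) (fun k => C.Y k ω) = C.dec (C.τ ω') (C.U ω') (fun k => C.Y k ω') := by
  have key : ∀ s t, s = t → s ≤ n → C.dec s (C.U ω) (fun k => C.Y k ω) =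
      C.dec t (C.U ω') (fun k => C.Y k ω') := by
    rintro s t rfl hs
    rw [h, show (fun k : Fin s => C.Y k ω) = fun k : Fin s => C.Y k ω' from
      funext fun k => h' k (k.2.trans_le hs)]
  exact key _ _ (C.τ_eq_of_eq h h' hn) hn

/-- Transmission is still going on at time `n` after the history `(u, y)`. -/
def Running (C : VLFCode δ L M ε) (n : ℕ) (u : C.S) (y : Fin n → BECOutput) : Prop :=
  ∃ ω, C.U ω = u ∧ (∀ k : Fin n, C.Y k ω = y k) ∧ n < C.τ ω

theorem running_iff (C : VLFCode δ L M ε) (n : ℕ) (ω : C.Ω) :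
    C.Running n (C.U ω) (fun k => C.Y k ω) ↔ n < C.τ ω := by
  refine ⟨?_, fun h => ⟨ω, rfl, fun _ => rfl, h⟩⟩
  rintro ⟨ω', hU, hY, hlt⟩
  rw [← not_le] at hlt ⊢
  rwa [← C.τ_le_iff_of_eq hU fun k hk => hY ⟨k, hk⟩]

/-- When the transmission of a zero-error code has stopped, one message is left. -/
theorem potential_eq_zero_of_not_running (C : VLFCode δ L M 0) {n : ℕ} {u : C.S}
    {y : Fin n → BECOutput} (h : ¬ C.Running n u y) :
    potential (jointMass C.μ C.U C.W C.Y n u y) = 0 := by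
  have hnull : C.μ {ω | C.dec (C.τ ω) (C.U ω) (fun k => C.Y k ω) ≠ C.W ω} = 0 :=
    (measureReal_eq_zero_iff).1 (le_antisymm C.error_le measureReal_nonneg)
  have key : ∀ w, jointMass C.μ C.U C.W C.Y n u y w ≠ 0 → ∃ ω, C.U ω = u ∧
      (∀ k : Fin n, C.Y k ω = y k) ∧ C.τ ω ≤ n ∧
        C.dec (C.τ ω) (C.U ω) (fun k => C.Y k ω) = w := by
    intro w hw
    by_contra! hcon
    refine hw ((measureReal_eq_zero_iff).2 (measure_mono_null ?_ hnull))
    rintro ω ⟨h1, h2, h3⟩ heq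
    exact hcon ω h1 h3 (not_lt.1 fun hlt => h ⟨ω, h1, h3, hlt⟩) (heq.trans h2)
  refine potential_eq_zero fun w w' hw hw' => ?_
  obtain ⟨ω, h1, h2, h3, rfl⟩ := key w hw
  obtain ⟨ω', h1', h2', -, rfl⟩ := key w' hw'
  exact C.dec_eq_of_eq (h1.trans h1'.symm)
    (fun k hk => (h2 ⟨k, hk⟩).trans (h2' ⟨k, hk⟩).symm) h3

/-- The expected potential of the messages that are left at time `n`. -/
noncomputable def runningPotential (C : VLFCode δ L M ε) (n : ℕ) : ℝ :=
  ∑ u, ∑ y, potential (jointMass C.μ C.U C.W C.Y n u y)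

-- The comparison is made history by history: a running one obeys `IsFlat.potential_le`, and a
-- stopped one has potential zero, so it needs no payment.
open Classical in
theorem runningPotential_le (C : VLFCode δ L M 0) (h0 : 0 ≤ δ) (h1 : δ < 1) (n : ℕ) :
    C.runningPotential n ≤ C.runningPotential (n + 1) + (1 - δ) * C.μ.real {ω | n < C.τ ω} := by
  have hQ := sum_jointMass (μ := C.μ) C.measurable_U C.measurable_W C.measurable_Y n
    (fun u y => C.Running n u y)
  simp only [C.running_iff] at hQ
  rw [← hQ, runningPotential, runningPotential, Finset.mul_sum, ← Finset.sum_add_distrib]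
  refine Finset.sum_le_sum fun u _ => ?_
  rw [sum_fin_succ_eq_sum_snoc, Finset.mul_sum, ← Finset.sum_add_distrib]
  refine Finset.sum_le_sum fun y _ => ?_
  split_ifs with hT
  · simp only [funext (C.jointMass_snoc_eq n u y _)]
    exact (C.isFlat_jointMass h0 h1 n u y).potential_le h1 fun w => C.enc n u w y
  · rw [C.potential_eq_zero_of_not_running hT, mul_zero, add_zero]
    exact Finset.sum_nonneg fun b _ => potential_nonneg fun w => jointMass_nonneg _ _ _ _ _ _ _ _

theorem runningPotential_zero (C : VLFCode δ L M ε) (hM : 1 ≤ M) :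
    C.runningPotential 0 = lstar M := by
  have hM' : (M : ℝ) ≠ 0 := by positivity
  have h : ∀ u (y : Fin 0 → BECOutput), potential (jointMass C.μ C.U C.W C.Y 0 u y) =
      C.μ.real {ω | C.U ω = u} * lstar M := by
    intro u y
    have := potential_ite (Finset.univ : Finset (Fin M)) (C.μ.real {ω | C.U ω = u} / M)
    simp only [Finset.mem_univ, if_true, Finset.card_univ, Fintype.card_fin, totalLength] at this
    rw [funext (C.jointMass_zero u y), this]
    field_simp
  have hsum : ∑ u, C.μ.real {ω | C.U ω = u} = 1 := by
    have := sum_measureReal_preimage_singleton (μ := C.μ) Finset.univ (f := C.U)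
      (fun u _ => C.measurable_U (measurableSet_singleton u)) 
    rw [Finset.coe_univ, Set.preimage_univ, probReal_univ] at this
    exact this
  simp only [runningPotential, h]
  simp [← Finset.sum_mul, hsum]

-- A crude bound that makes the remainder of the telescoped inequality vanish: only running
-- histories contribute, and their probability tends to zero.
open Classical in
theorem runningPotential_le_mul (C : VLFCode δ L M 0) (n : ℕ) :
    C.runningPotential n ≤
      (∑ m ∈ Finset.range (M + 1), lstar m) * C.μ.real {ω | n < C.τ ω} := by
  have hQ := sum_jointMass (μ := C.μ) C.measurable_U C.measurable_W C.measurable_Y n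
    (fun u y => C.Running n u y)
  simp only [C.running_iff] at hQ
  rw [← hQ, runningPotential, Finset.mul_sum]
  refine Finset.sum_le_sum fun u _ => ?_
  rw [Finset.mul_sum]
  refine Finset.sum_le_sum fun y _ => ?_
  split_ifs with hT
  · rw [potential, mul_comm]
    refine mul_le_mul_of_nonneg_right ?_
      (Finset.sum_nonneg fun w _ => jointMass_nonneg _ _ _ _ _ _ _ _)
    -- The sum of all `lstar m` with `m ≤ M` dominates each term, so monotonicity of `lstar` is not
    -- needed.
    refine Finset.single_le_sum (f := fun m : ℕ => lstar m)
      (fun m _ => lstar_natCast_nonneg m) (Finset.mem_range_succ_iff.2 ?_)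
    exact (Finset.card_le_univ _).trans (by simp)
  · rw [C.potential_eq_zero_of_not_running hT, mul_zero]

theorem measurableSet_lt_τ (C : VLFCode δ L M ε) (n : ℕ) : MeasurableSet {ω | n < C.τ ω} := by
  have h := (feedbackFiltration C.U C.Y C.measurable_U C.measurable_Y).le n _ (C.isStoppingTime n)
  convert h.compl using 1
  ext ω
  simp

theorem sum_measureReal_lt_τ_le (C : VLFCode δ L M ε) (N : ℕ) :
    ∑ n ∈ Finset.range N, C.μ.real {ω | n < C.τ ω} ≤ L := by
  have h := C.expectation_le
  rw [lintegral_natCast_eq_tsum C.μ C.measurableSet_lt_τ] at h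
  have h' := (ENNReal.sum_le_tsum (Finset.range N)).trans h
  simp only [Measure.real]
  rw [← ENNReal.toReal_sum fun n _ => measure_ne_top _ _]
  exact ENNReal.toReal_le_of_le_ofReal C.L_nonneg h'

theorem lstar_div_le (C : VLFCode δ L M 0) (h0 : 0 ≤ δ) (h1 : δ < 1) (hM : 1 ≤ M) :
    lstar M / (1 - δ) ≤ L := by
  have hδ : 0 < 1 - δ := by linarith
  have hsum : Summable fun n => C.μ.real {ω | n < C.τ ω} :=
    summable_of_sum_range_le (fun n => measureReal_nonneg) C.sum_measureReal_lt_τ_le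
  have hstep : ∀ N, lstar M ≤ C.runningPotential N +
      (1 - δ) * ∑ n ∈ Finset.range N, C.μ.real {ω | n < C.τ ω} := by
    intro N
    induction N with
    | zero => simp [C.runningPotential_zero hM]
    | succ N ih =>
      have := C.runningPotential_le h0 h1 N
      rw [Finset.sum_range_succ]
      linarith
  have hlim := (hsum.tendsto_atTop_zero.const_mul
    (∑ m ∈ Finset.range (M + 1), lstar m)).add_const ((1 - δ) * L)
  rw [mul_zero, zero_add] at hlim
  rw [div_le_iff₀' hδ]
  refine ge_of_tendsto' hlim fun N => (hstep N).trans ?_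
  exact add_le_add (C.runningPotential_le_mul N)
    (mul_le_mul_of_nonneg_left (C.sum_measureReal_lt_τ_le N) hδ.le)

end VLFCode

/-! ### Achievability: analysis of the bisection scheme. -/

section Bisection

/-- The state `(a, s)` stands for the candidate messages `a ≤ w < a + s`. The next bit to be sent
tells whether the message is in the upper half. -/
def bisectBit (s : ℕ × ℕ) (w : ℕ) : Bool := decide (s.1 + s.2 / 2 ≤ w)

/-- The candidates after a channel output. -/
def bisectStep (s : ℕ × ℕ) : BECOutput → ℕ × ℕ
  | none => s
  | some false => (s.1, s.2 / 2)
  | some true => (s.1 + s.2 / 2, s.2 - s.2 / 2)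

/-- The candidates after the first `n` outputs. -/
def bisectState (M : ℕ) (y : ℕ → BECOutput) : ℕ → ℕ × ℕ
  | 0 => (0, M)
  | n + 1 => bisectStep (bisectState M y n) (y n)

theorem bisectState_congr (M : ℕ) {y y' : ℕ → BECOutput} {n : ℕ} (h : ∀ k < n, y k = y' k) :
    bisectState M y n = bisectState M y' n := by
  induction n with
  | zero => rfl
  | succ n ih =>
    rw [bisectState, bisectState, ih fun k hk => h k (hk.trans n.lt_succ_self), h n n.lt_succ_self]

theorem bisectState_add_le (M : ℕ) (y : ℕ → BECOutput) (n : ℕ) :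
    (bisectState M y n).1 + (bisectState M y n).2 ≤ M := by
  induction n with
  | zero => simp [bisectState]
  | succ n ih =>
    rw [bisectState]
    rcases y n with _ | _ | _ <;> simp only [bisectStep] <;> omega

/-- A finite output sequence, continued by erasures. -/
def extendOutputs {n : ℕ} (y : Fin n → BECOutput) (k : ℕ) : BECOutput :=
  if h : k < n then y ⟨k, h⟩ else none

theorem extendOutputs_of_lt {n : ℕ} (y : Fin n → BECOutput) {k : ℕ} (h : k < n) :
    extendOutputs y k = y ⟨k, h⟩ := dif_pos h

theorem extendOutputs_snoc_of_lt {n : ℕ} (y : Fin n → BECOutput) (b : BECOutput) {k : ℕ}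
    (h : k < n) : extendOutputs (Fin.snoc y b : Fin (n + 1) → BECOutput) k = extendOutputs y k := by
  rw [extendOutputs_of_lt _ (h.trans n.lt_succ_self), extendOutputs_of_lt _ h]
  exact Fin.snoc_castSucc (α := fun _ => BECOutput) b y ⟨k, h⟩

theorem extendOutputs_snoc_self {n : ℕ} (y : Fin n → BECOutput) (b : BECOutput) :
    extendOutputs (Fin.snoc y b : Fin (n + 1) → BECOutput) n = b := by
  rw [extendOutputs_of_lt _ n.lt_succ_self]
  exact Fin.snoc_last (α := fun _ => BECOutput) b y

/-- The candidates after the outputs `y`. -/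
def bisectHistory (M : ℕ) {n : ℕ} (y : Fin n → BECOutput) : ℕ × ℕ :=
  bisectState M (extendOutputs y) n

theorem bisectHistory_restrict (M n : ℕ) (y : ℕ → BECOutput) :
    bisectHistory M (fun k : Fin n => y k) = bisectState M y n :=
  bisectState_congr M fun _ hk => extendOutputs_of_lt _ hk

theorem bisectHistory_snoc (M : ℕ) {n : ℕ} (y : Fin n → BECOutput) (b : BECOutput) :
    bisectHistory M (Fin.snoc y b : Fin (n + 1) → BECOutput) =
      bisectStep (bisectHistory M y) b := by
  rw [bisectHistory, bisectState, extendOutputs_snoc_self, bisectHistory,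
    bisectState_congr M fun k hk => extendOutputs_snoc_of_lt y b hk]

/-- The candidate messages of a state. -/
def candidates (M : ℕ) (s : ℕ × ℕ) : Finset (Fin M) :=
  Finset.univ.filter fun w => s.1 ≤ w ∧ (w : ℕ) < s.1 + s.2

theorem mem_candidates {M : ℕ} {s : ℕ × ℕ} {w : Fin M} :
    w ∈ candidates M s ↔ s.1 ≤ w ∧ (w : ℕ) < s.1 + s.2 := by
  simp [candidates]

theorem card_candidates {M : ℕ} {s : ℕ × ℕ} (h : s.1 + s.2 ≤ M) : (candidates M s).card = s.2 := by
  have : (candidates M s).map Fin.valEmbedding = Finset.Ico s.1 (s.1 + s.2) := by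
    ext w
    simp only [candidates, Finset.mem_map, Finset.mem_filter, Finset.mem_univ, true_and,
      Fin.valEmbedding_apply, Finset.mem_Ico]
    constructor
    · rintro ⟨v, hv, rfl⟩
      exact hv
    · intro hw
      exact ⟨⟨w, by omega⟩, hw, rfl⟩
  rw [← Finset.card_map, this, Nat.card_Ico]
  omega

theorem filter_candidates (M : ℕ) (s : ℕ × ℕ) (x : Bool) :
    ((candidates M s).filter fun w : Fin M => bisectBit s w = x) =
      candidates M (bisectStep s (some x)) := by
  ext w
  rw [Finset.mem_filter, mem_candidates, mem_candidates]
  cases x <;> simp only [bisectBit, bisectStep, decide_eq_true_eq, decide_eq_false_iff_not] <;>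
    omega

variable {Ω : Type} [MeasurableSpace Ω] {M : ℕ} {μ : Measure Ω} {W : Ω → Fin M}
  {Y : ℕ → Ω → BECOutput} {δ : ℝ}

/-- The joint distribution of the message and the outputs when the bisection encoder is used. -/
structure IsBisection (μ : Measure Ω) (W : Ω → Fin M) (Y : ℕ → Ω → BECOutput) (δ : ℝ) : Prop where
  measurable_W : Measurable W
  measurable_Y : ∀ n, Measurable (Y n)
  zero : ∀ (y : Fin 0 → BECOutput) (w : Fin M), jointMass μ (fun _ => ()) W Y 0 () y w = 1 / M
  snoc : ∀ (n : ℕ) (y : Fin n → BECOutput) (b : BECOutput) (w : Fin M),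
    jointMass μ (fun _ => ()) W Y (n + 1) () (Fin.snoc y b) w =
      jointMass μ (fun _ => ()) W Y n () y w * becTransition δ (bisectBit (bisectHistory M y) w) b

/-- The interval state computed from the outputs alone carries the whole posterior: it is uniform on
the candidates. A history that cannot occur is covered by `c = 0` or by an empty interval. -/
theorem IsBisection.exists_eq_ite (h : IsBisection μ W Y δ) (n : ℕ) (y : Fin n → BECOutput) :
    ∃ c, jointMass μ (fun _ => ()) W Y n () y =
      fun w => if w ∈ candidates M (bisectHistory M y) then c else 0 := by
  induction n with
  | zero =>
    refine ⟨1 / M, funext fun w => ?_⟩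
    rw [h.zero, if_pos]
    simp [candidates, bisectHistory, bisectState]
  | succ n ih =>
    obtain ⟨c, hc⟩ := ih (Fin.init y)
    rw [← Fin.snoc_init_self y]
    generalize Fin.init y = z at *
    rcases y (Fin.last n) with _ | x
    · refine ⟨c * δ, funext fun w => ?_⟩
      rw [h.snoc, hc, bisectHistory_snoc]
      change _ = if w ∈ candidates M (bisectHistory M z) then _ else _
      simp [becTransition]
    · refine ⟨c * (1 - δ), funext fun w => ?_⟩
      rw [h.snoc, hc, bisectHistory_snoc, ← filter_candidates]
      by_cases hw : w ∈ candidates M (bisectHistory M z) <;>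
        by_cases hx : bisectBit (bisectHistory M z) w = x <;>
          simp [hw, hx, becTransition, eq_comm (a := x)]

/-- The one-step inequality of the converse is here an exact balance, by `totalLength_half`; with at
most one candidate every term is zero. -/
theorem IsBisection.potential_eq (h : IsBisection μ W Y δ) (n : ℕ) (y : Fin n → BECOutput) :
    potential (jointMass μ (fun _ => ()) W Y n () y) =
      ∑ b, potential (jointMass μ (fun _ => ()) W Y (n + 1) () (Fin.snoc y b)) +
        (1 - δ) * if 2 ≤ (bisectHistory M y).2 then
          ∑ w, jointMass μ (fun _ => ()) W Y n () y w else 0 := by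
  obtain ⟨c, hc⟩ := h.exists_eq_ite n y
  have hle : (bisectHistory M y).1 + (bisectHistory M y).2 ≤ M := bisectState_add_le M _ n
  simp only [funext (h.snoc n y _), hc]
  rw [sum_potential_mul_becTransition, potential_ite, filter_candidates, filter_candidates,
    card_candidates, card_candidates, card_candidates]
  · simp only [bisectStep]
    split_ifs with h2
    · have hsum : ∑ w, (if w ∈ candidates M (bisectHistory M y) then c else 0) =
          c * (bisectHistory M y).2 := by
        simp [card_candidates hle, mul_comm]
      rw [hsum, totalLength_half h2]
      ring
    · rw [totalLength_eq_zero_of_le_one (m := (bisectHistory M y).2) (by omega),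
        totalLength_eq_zero_of_le_one (by omega), totalLength_eq_zero_of_le_one (by omega)]
      ring
  all_goals first | omega | (simp only [bisectStep]; omega)

/-- The balance telescopes, and the nonnegative final potential is dropped. The bound serves twice:
for the expected stopping time, and to show that bisection ends almost surely. -/
theorem IsBisection.sum_measureReal [IsFiniteMeasure μ] (h : IsBisection μ W Y δ) (h1 : δ < 1)
    (hM : 1 ≤ M) (N : ℕ) :
    ∑ n ∈ Finset.range N, μ.real {ω | 2 ≤ (bisectState M (fun k => Y k ω) n).2} ≤
      lstar M / (1 - δ) := by
  have hδ : 0 < 1 - δ := by linarith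
  have hM' : (M : ℝ) ≠ 0 := by positivity
  let Φ : ℕ → ℝ := fun n =>
    ∑ y : Fin n → BECOutput, potential (jointMass μ (fun _ => ()) W Y n () y)
  have hΦ0 : Φ 0 = lstar M := by
    have := potential_ite (Finset.univ : Finset (Fin M)) (1 / M)
    simp only [Finset.mem_univ, if_true, Finset.card_univ, Fintype.card_fin, totalLength] at this
    simp only [Φ, funext (h.zero _), Finset.univ_unique, Finset.sum_singleton]
    rw [this]
    field_simp
  have hΦ : ∀ n, Φ n = Φ (n + 1) +
      (1 - δ) * μ.real {ω | 2 ≤ (bisectState M (fun k => Y k ω) n).2} := by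
    intro n
    have hQ := sum_jointMass (μ := μ) (measurable_const (a := ())) h.measurable_W h.measurable_Y n
      (fun _ y => 2 ≤ (bisectHistory M y).2)
    simp only [fun ω => bisectHistory_restrict M n fun k => Y k ω, Finset.univ_unique,
      Finset.sum_singleton] at hQ
    simp only [Φ]
    rw [← hQ, sum_fin_succ_eq_sum_snoc, Finset.mul_sum, ← Finset.sum_add_distrib]
    exact Finset.sum_congr rfl fun y _ => h.potential_eq n y
  have hstep : lstar M = Φ N + (1 - δ) *
      ∑ n ∈ Finset.range N, μ.real {ω | 2 ≤ (bisectState M (fun k => Y k ω) n).2} := by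
    induction N with
    | zero => simp [hΦ0]
    | succ N ih =>
      rw [Finset.sum_range_succ, ih, hΦ N]
      ring
  have hpos : 0 ≤ Φ N :=
    Finset.sum_nonneg fun y _ => potential_nonneg fun w => jointMass_nonneg _ _ _ _ _ _ _ _
  rw [le_div_iff₀' hδ]
  linarith

theorem measurable_bisectState {Ω : Type*} [MeasurableSpace Ω] (M : ℕ) {Y : ℕ → Ω → BECOutput}
    {n : ℕ} (hY : ∀ k < n, Measurable (Y k)) :
    Measurable fun ω => bisectState M (fun k => Y k ω) n := by
  have : DiscreteMeasurableSpace BECOutput := ⟨fun _ => trivial⟩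
  induction n with
  | zero => exact measurable_const
  | succ n ih =>
    exact (measurable_of_countable fun p : (ℕ × ℕ) × BECOutput => bisectStep p.1 p.2).comp
      ((ih fun k hk => hY k (hk.trans n.lt_succ_self)).prodMk (hY n n.lt_succ_self))

end Bisection

/-! ### A probability space carrying the scheme, and the resulting code. -/

section Construction

/-- The channel output for the input `x`, with `e` telling whether there is an erasure. -/
def eraseIf (e : Bool) (x : Bool) : BECOutput := if e then none else some x

/-- The candidates after `n` uses of the channel, for the message `w` and the erasure pattern
`e`. -/
def bisectPath (M w : ℕ) (e : ℕ → Bool) : ℕ → ℕ × ℕ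
  | 0 => (0, M)
  | n + 1 => bisectStep (bisectPath M w e n) (eraseIf (e n) (bisectBit (bisectPath M w e n) w))

/-- The channel outputs for the message `w` and the erasure pattern `e`. -/
def bisectOutput (M w : ℕ) (e : ℕ → Bool) (n : ℕ) : BECOutput :=
  eraseIf (e n) (bisectBit (bisectPath M w e n) w)

theorem bisectState_bisectOutput (M w : ℕ) (e : ℕ → Bool) (n : ℕ) :
    bisectState M (bisectOutput M w e) n = bisectPath M w e n := by
  induction n with
  | zero => rfl
  | succ n ih => rw [bisectState, ih]; rfl

theorem mem_bisectPath {M w : ℕ} (hw : w < M) (e : ℕ → Bool) (n : ℕ) :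
    (bisectPath M w e n).1 ≤ w ∧ w < (bisectPath M w e n).1 + (bisectPath M w e n).2 := by
  induction n with
  | zero => simpa [bisectPath] using hw
  | succ n ih =>
    rw [bisectPath]
    generalize bisectPath M w e n = s at *
    by_cases he : e n = true
    · simpa [he, eraseIf, bisectStep] using ih
    · by_cases hb : s.1 + s.2 / 2 ≤ w <;>
        simp only [eraseIf, he, bisectBit, hb, decide_true, decide_false, bisectStep] <;>
        simp only [Bool.false_eq_true, if_false] <;> omega

/-- This removes the feedback: once the earlier outputs are those of `y`, the encoder's state is a
function of `y`. The event becomes a conjunction of conditions on separate erasure indicators, to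
which the product measure applies. -/
theorem forall_bisectOutput_eq_iff (M w : ℕ) (e : ℕ → Bool) (y : ℕ → BECOutput) (n : ℕ) :
    (∀ k < n, bisectOutput M w e k = y k) ↔
      ∀ k < n, eraseIf (e k) (bisectBit (bisectState M y k) w) = y k := by
  induction n with
  | zero => simp
  | succ n ih =>
    rw [Nat.forall_lt_succ_right, Nat.forall_lt_succ_right, ← ih]
    refine and_congr_right fun h => ?_
    rw [bisectOutput, ← bisectState_bisectOutput, bisectState_congr M h]

/-- The distribution of an erasure indicator. -/
noncomputable def erasureMeasure (δ : ℝ) : Measure Bool :=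
  ENNReal.ofReal δ • Measure.dirac true + ENNReal.ofReal (1 - δ) • Measure.dirac false

theorem isProbabilityMeasure_erasureMeasure {δ : ℝ} (h0 : 0 ≤ δ) (h1 : δ < 1) :
    IsProbabilityMeasure (erasureMeasure δ) := by
  constructor
  simp only [erasureMeasure, Measure.coe_add, Pi.add_apply, Measure.smul_apply, measure_univ,
    smul_eq_mul, mul_one]
  rw [← ENNReal.ofReal_add h0 (by linarith)]
  simp

theorem erasureMeasure_eraseIf (δ : ℝ) (x : Bool) (b : BECOutput) :
    erasureMeasure δ {e | eraseIf e x = b} = ENNReal.ofReal (becTransition δ x b) := by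
  rcases b with _ | b
  · simp [erasureMeasure, eraseIf, becTransition]
  · by_cases hx : x = b <;>
      simp [erasureMeasure, eraseIf, becTransition, hx, eq_comm (a := b)]

/-- The message is uniform, and the erasures are independent of it and of each other. -/
noncomputable def bisectMeasure (M : ℕ) (δ : ℝ) : Measure (Fin M × (ℕ → Bool)) :=
  (uniformOn Set.univ).prod (Measure.infinitePi fun _ => erasureMeasure δ)

variable {M : ℕ} {δ : ℝ}

theorem isProbabilityMeasure_bisectMeasure (h0 : 0 ≤ δ) (h1 : δ < 1) (hM : 1 ≤ M) :
    IsProbabilityMeasure (bisectMeasure M δ) := by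
  have := isProbabilityMeasure_erasureMeasure h0 h1
  have : Nonempty (Fin M) := ⟨⟨0, hM⟩⟩
  have : IsProbabilityMeasure (uniformOn (Set.univ : Set (Fin M))) :=
    isProbabilityMeasure_uniformOn Set.finite_univ Set.univ_nonempty
  unfold bisectMeasure
  infer_instance

theorem jointMass_bisectMeasure (h0 : 0 ≤ δ) (h1 : δ < 1) (n : ℕ) (y : Fin n → BECOutput)
    (w : Fin M) :
    jointMass (bisectMeasure M δ) (fun _ => ()) Prod.fst (fun k ω => bisectOutput M ω.1 ω.2 k)
      n () y w = 1 / M * ∏ k ∈ Finset.range n,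
        becTransition δ (bisectBit (bisectState M (extendOutputs y) k) w) (extendOutputs y k) := by
  have := isProbabilityMeasure_erasureMeasure h0 h1
  have hset : {ω : Fin M × (ℕ → Bool) | () = () ∧ ω.1 = w ∧
      ∀ k : Fin n, bisectOutput M ω.1 ω.2 k = y k} = {w} ×ˢ Set.pi (Finset.range n)
        (fun k => {e | eraseIf e (bisectBit (bisectState M (extendOutputs y) k) w) =
          extendOutputs y k}) := by
    ext ⟨v, e⟩
    simp only [true_and, Set.mem_ofPred_eq, Set.mem_prod, Set.mem_singleton_iff, Set.mem_pi,
      Finset.coe_range, Set.mem_Iio]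
    refine and_congr_right fun hv => ?_
    subst hv
    rw [← forall_bisectOutput_eq_iff]
    exact ⟨fun h k hk => (h ⟨k, hk⟩).trans (extendOutputs_of_lt y hk).symm,
      fun h k => (h k k.2).trans (extendOutputs_of_lt y k.2)⟩
  rw [jointMass, hset, Measure.real, bisectMeasure, Measure.prod_prod,
    Measure.infinitePi_pi _ fun _ _ => MeasurableSet.of_discrete]
  simp only [erasureMeasure_eraseIf]
  rw [← ENNReal.ofReal_prod_of_nonneg fun _ _ => becTransition_nonneg h0 h1 _ _, ENNReal.toReal_mul,
    ENNReal.toReal_ofReal (Finset.prod_nonneg fun _ _ => becTransition_nonneg h0 h1 _ _),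
    uniformOn_univ]
  simp

theorem measurable_bisectOutput (M n : ℕ) :
    Measurable fun ω : Fin M × (ℕ → Bool) => bisectOutput M ω.1 ω.2 n := by
  have : DiscreteMeasurableSpace BECOutput := ⟨fun _ => trivial⟩
  induction n using Nat.strong_induction_on with
  | _ n ih =>
    have h1 := measurable_bisectState M ih
    have h2 : Measurable fun ω : Fin M × (ℕ → Bool) => ω.2 n :=
      (measurable_pi_apply n).comp measurable_snd
    have h3 := (measurable_of_countable fun p : ((ℕ × ℕ) × Bool) × Fin M =>
      eraseIf p.1.2 (bisectBit p.1.1 p.2)).comp ((h1.prodMk h2).prodMk measurable_fst)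
    convert h3 using 1
    ext1 ω
    simp only [Function.comp]
    rw [show (fun k => bisectOutput M ω.1 ω.2 k) = bisectOutput M ω.1 ω.2 from rfl,
      bisectState_bisectOutput, bisectOutput]

theorem isBisection_bisectMeasure (h0 : 0 ≤ δ) (h1 : δ < 1) :
    IsBisection (bisectMeasure M δ) Prod.fst (fun k ω => bisectOutput M ω.1 ω.2 k) δ where
  measurable_W := measurable_fst
  measurable_Y := measurable_bisectOutput M
  zero y w := by simp [jointMass_bisectMeasure h0 h1]
  snoc n y b w := by
    rw [jointMass_bisectMeasure h0 h1, jointMass_bisectMeasure h0 h1, Finset.prod_range_succ,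
      ← mul_assoc, extendOutputs_snoc_self]
    congr 1
    · congr 1
      refine Finset.prod_congr rfl fun k hk => ?_
      have hk := Finset.mem_range.1 hk
      rw [extendOutputs_snoc_of_lt y b hk, bisectState_congr M fun j hj =>
        extendOutputs_snoc_of_lt y b (hj.trans hk)]
    · rw [bisectHistory, bisectState_congr M fun j hj => extendOutputs_snoc_of_lt y b hj]

/-- The outputs may be altered on a null set. This is needed because `τ` takes values in `ℕ`, so
bisection must end at every point and not just almost everywhere. -/
theorem IsBisection.congr {Ω : Type} [MeasurableSpace Ω] {μ : Measure Ω} {W : Ω → Fin M}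
    {Y Y' : ℕ → Ω → BECOutput} (h : IsBisection μ W Y δ) (hY : ∀ n, Measurable (Y' n))
    (hae : ∀ᵐ ω ∂μ, ∀ n, Y' n ω = Y n ω) : IsBisection μ W Y' δ := by
  have hmass : ∀ n (y : Fin n → BECOutput) w, jointMass μ (fun _ => ()) W Y' n () y w =
      jointMass μ (fun _ => ()) W Y n () y w := by
    intro n y w
    refine measureReal_congr ?_
    filter_upwards [hae] with ω hω
    apply propext
    change (() = () ∧ W ω = w ∧ ∀ k : Fin n, Y' k ω = y k) ↔
      (() = () ∧ W ω = w ∧ ∀ k : Fin n, Y k ω = y k)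
    simp only [hω]
  exact ⟨h.measurable_W, hY, fun y w => by rw [hmass, h.zero],
    fun n y b w => by rw [hmass, hmass, h.snoc]⟩

/-- A bisection process which always ends, and whose last candidate is almost surely the message,
yields a zero-error code. -/
theorem IsBisection.nonempty_vlfCode {Ω : Type} [MeasurableSpace Ω] {μ : Measure Ω}
    [IsProbabilityMeasure μ] {W : Ω → Fin M} {Y : ℕ → Ω → BECOutput} (h : IsBisection μ W Y δ)
    (h1 : δ < 1) (hM : 1 ≤ M)
    (hend : ∀ ω, ∃ n, (bisectState M (fun k => Y k ω) n).2 ≤ 1)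
    (hmem : ∀ᵐ ω ∂μ, ∀ n, W ω ∈ candidates M (bisectState M (fun k => Y k ω) n)) :
    Nonempty (VLFCode δ (lstar M / (1 - δ)) M 0) := by
  have hL : 0 ≤ lstar M / (1 - δ) := div_nonneg (lstar_natCast_nonneg M) (by linarith)
  have hlt : ∀ n, {ω | n < Nat.find (hend ω)} ⊆
      {ω | 2 ≤ (bisectState M (fun k => Y k ω) n).2} := by
    intro n ω hω
    exact not_le.1 (Nat.find_min (hend ω) hω)
  have hτ : IsStoppingTime (feedbackFiltration (fun _ => ()) Y measurable_const h.measurable_Y)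
      (fun ω => (Nat.find (hend ω) : WithTop ℕ)) := by
    intro n
    -- Stopping by time `n` means that some state of index `j ≤ n` has at most one candidate, which
    -- is decided by the first `j` outputs.
    have heq : {ω | (Nat.find (hend ω) : WithTop ℕ) ≤ n} =
        ⋃ j ∈ Set.Iic n, (fun ω => bisectState M (fun k => Y k ω) j) ⁻¹' {s | s.2 ≤ 1} := by
      ext ω
      simp [Nat.find_le_iff]
    refine heq ▸ MeasurableSet.biUnion (Set.to_countable _) fun j hj => ?_
    refine @measurable_bisectState Ω (feedbackFiltration _ Y measurable_const h.measurable_Y n) M Y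
      j (fun k hk => Measurable.mono (comap_measurable (Y k)) ?_ le_rfl) _ MeasurableSet.of_discrete
    exact le_sup_of_le_right (le_iSup₂_of_le k (lt_of_lt_of_le hk hj) le_rfl)
  refine ⟨{
    L_nonneg := hL
    ε_mem := ⟨le_rfl, zero_le_one⟩
    S := Unit
    card_S_le := by simp
    enc := fun n _ w y => bisectBit (bisectHistory M y) w
    -- The default message `0` only makes the decoder total: almost surely the left endpoint at the
    -- stopping time is the message.
    dec := fun n _ y =>
      if h : (bisectHistory M y).1 < M then ⟨(bisectHistory M y).1, h⟩ else ⟨0, hM⟩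
    Ω := Ω
    μ := μ
    U := fun _ => ()
    W := W
    Y := Y
    measurable_U := measurable_const
    measurable_W := h.measurable_W
    measurable_Y := h.measurable_Y
    uniform_W := fun w => by
      rw [← h.zero Fin.elim0 w]
      simp [jointMass]
    indep_U_W := indepFun_const_left () W
    channel := fun n u w y b => by
      have := h.snoc n y b w
      rw [jointMass_snoc] at this
      exact this
    τ := fun ω => Nat.find (hend ω)
    isStoppingTime := hτ
    expectation_le := ?_
    error_le := ?_ }⟩
  · have hmeas : ∀ n, MeasurableSet {ω | n < Nat.find (hend ω)} := by
      intro n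
      have := (feedbackFiltration (fun _ => ()) Y measurable_const h.measurable_Y).le n _ (hτ n)
      convert this.compl using 1
      ext ω
      simp
    rw [lintegral_natCast_eq_tsum μ hmeas]
    refine ENNReal.tsum_le_of_sum_range_le fun N => ?_
    refine (Finset.sum_le_sum fun n _ => measure_mono (hlt n)).trans ?_
    rw [← ENNReal.toReal_le_toReal (ENNReal.sum_ne_top.2 fun n _ => measure_ne_top _ _)
      ENNReal.ofReal_ne_top, ENNReal.toReal_ofReal hL,
      ENNReal.toReal_sum fun n _ => measure_ne_top _ _]
    exact h.sum_measureReal h1 hM N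
  · refine le_of_eq ((measureReal_eq_zero_iff).2 ?_)
    refine measure_mono_null ?_ (ae_iff.1 hmem)
    intro ω hω hcon
    refine hω ?_
    have h2 := hcon (Nat.find (hend ω))
    have h3 := Nat.find_spec (hend ω)
    rw [mem_candidates] at h2
    -- An interval of length at most one that contains `W ω` starts at `W ω`.
    have h4 : (bisectState M (fun k => Y k ω) (Nat.find (hend ω))).1 = W ω := by omega
    rw [← bisectHistory_restrict] at h4
    have h5 := (W ω).2
    ext
    rw [dif_pos (by omega)]
    exact h4

theorem nonempty_vlfCode (h0 : 0 ≤ δ) (h1 : δ < 1) (hM : 1 ≤ M) :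
    Nonempty (VLFCode δ (lstar M / (1 - δ)) M 0) := by
  have := isProbabilityMeasure_bisectMeasure h0 h1 hM
  have h := isBisection_bisectMeasure (M := M) h0 h1
  -- `B` is the event that bisection never ends. It is null because the probabilities of the events
  -- being intersected are summable, hence tend to zero.
  let B : Set (Fin M × (ℕ → Bool)) :=
    ⋂ n, {ω | 2 ≤ (bisectState M (bisectOutput M ω.1 ω.2) n).2}
  have hBm : MeasurableSet B := MeasurableSet.iInter fun n =>
    measurable_bisectState M (fun k _ => measurable_bisectOutput M k)
      (MeasurableSet.of_discrete (s := {s : ℕ × ℕ | 2 ≤ s.2}))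
  have hsum := summable_of_sum_range_le (fun n => measureReal_nonneg)
    (h.sum_measureReal h1 hM)
  have hB : bisectMeasure M δ B = 0 := by
    refine (measureReal_eq_zero_iff).1 (le_antisymm ?_ measureReal_nonneg)
    exact ge_of_tendsto' hsum.tendsto_atTop_zero fun n => measureReal_mono (Set.iInter_subset _ n)
  obtain ⟨ω₀, hω₀⟩ : ∃ ω₀, ω₀ ∉ B := by
    by_contra! hcon
    rw [Set.eq_univ_of_forall hcon, measure_univ] at hB
    exact one_ne_zero hB
  classical
  -- Points of `B` borrow the outputs of `ω₀`, where bisection ends. The message is left unchanged,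
  -- so it is among the candidates only almost surely.
  let r : Fin M × (ℕ → Bool) → Fin M × (ℕ → Bool) := B.piecewise (fun _ => ω₀) id
  have hr : Measurable r := measurable_const.piecewise hBm measurable_id
  have hrB : ∀ ω, r ω ∉ B := by
    intro ω
    by_cases hω : ω ∈ B
    · simpa [r, hω] using hω₀
    · simp [r, hω]
  have hae : ∀ᵐ ω ∂bisectMeasure M δ, r ω = ω := by
    filter_upwards [measure_eq_zero_iff_ae_notMem.1 hB] with ω hω
    simp [r, hω]
  have h' : IsBisection (bisectMeasure M δ) Prod.fst
      (fun k ω => bisectOutput M (r ω).1 (r ω).2 k) δ := by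
    refine h.congr (fun n => (measurable_bisectOutput M n).comp hr) ?_
    filter_upwards [hae] with ω hω n
    rw [hω]
  refine h'.nonempty_vlfCode h1 hM (fun ω => ?_) ?_
  · have := hrB ω
    simp only [B, Set.mem_iInter, not_forall, Set.mem_ofPred_eq, not_le] at this
    obtain ⟨n, hn⟩ := this
    exact ⟨n, Nat.le_of_lt_succ hn⟩
  · filter_upwards [hae] with ω hω n
    rw [hω, show (fun k => bisectOutput M ω.1 ω.2 k) = bisectOutput M ω.1 ω.2 from rfl,
      bisectState_bisectOutput]
    simpa [mem_candidates] using mem_bisectPath ω.1.2 ω.2 n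

end Construction

theorem mainTheorem3 (δ : ℝ) (hδ0 : 0 ≤ δ) (hδ1 : δ < 1) (M : ℕ) (hM : 1 ≤ M) :
    IsLeast (vlfBlocklengths δ M 0) (lstar (M : ℝ) / (1 - δ)) :=
  ⟨nonempty_vlfCode hδ0 hδ1 hM, fun _ ⟨C⟩ => C.lstar_div_le hδ0 hδ1 hM⟩
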